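/- \textbf{Setting.} Let $T>0$, $d\ge 1$, and let $\boldsymbol x\in C^\infty([0,T])^d$ solve the autonomous system $\boldsymbol x'(t)=\boldsymbol f(\boldsymbol x(t))$ on $[0,T]$. Put $\Delta=\{\boldsymbol x(t):0\le t\le T\}$, let $f$ be a component of $\boldsymbol f$ and let $x$ denote the corresponding component of $\boldsymbol x$. Let $\Delta'\supseteq\Delta$ be a connected set (for instance a small neighbourhood of $\Delta$) with $\Delta'\subseteq[-R,R]^d$, $R>0$, on which $f$ is uniformly continuous, and let $\omega_f(r)=\sup\{|f(y)-f(z)|: y,z\in\Delta',\ \|y-z\|_2\le r\}$. \textbf{Multistep method.} Let $\sum_{m=0}^M\alpha_m\boldsymbol x_{n-m}=h\sum_{m=0}^M\beta_m\boldsymbol f(\boldsymbol x_{n-m})$, with $M\ge1$, $\alpha_0\ne0$ and not all $\beta_m$ zero, be an LMM of order $p\ge1$: along every smooth solution of an autonomous system on a bounded interval the local truncation error $\frac1h\sum_m\alpha_m\boldsymbol x(t_{n-m})-\sum_m\beta_m\boldsymbol f(\boldsymbol x(t_{n-m}))$ is at most a constant times $h^p$, the constant being independent of $n$ and $h$. Let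 $\mu_0,\dots,\mu_p$ be the coefficients of a finite difference formula of order $p$: for every smooth $y$ on a bounded interval, $\frac1h\sum_{m=0}^p\mu_m y(t+mh)-y'(t)=O(h^p)$ uniformly in $t$. For an integer $N_1\ge M$ put $h=T/N_1$, $t_n=nh$, $\boldsymbol x_n=\boldsymbol x(t_n)$, $x_n=x(t_n)$. Let $r$ and $q$ be the first and last index $n$ for which $\boldsymbol f(\boldsymbol x_n)$ occurs with nonzero coefficient in the scheme for $n=M,\dots,N_1$; put $\tau=q-r+1$ and $N_a=\tau-(N_1-M+1)$, and assume that $N_1$ is large enough that the finite differences below use only $\boldsymbol x_0,\dots,\boldsymbol x_{N_1}$. Let $$J_{a,h}(u)=\frac1\tau\Bigl(\sum_{n=r}^{r+N_a-1}\Bigl|u(\boldsymbol x_n)-\frac1h\sum_{m=0}^p\mu_mx_{n+m}\Bigr|^2+\sum_{n=M}^{N_1}\Bigl|\sum_{m=0}^M\beta_mu(\boldsymbol x_{n-m})-\frac1h\sum_{m=0}^M\alpha_mx_{n-m}\Bigr|^2\Bigr),$$ and let $A_h\in\mathbb R^{\tau\times\tau}$ be the matrix that maps $(u(\boldsymbol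 x_r),\dots,u(\boldsymbol x_q))$ to the vector of the $u(\boldsymbol x_n)$, $r\le n<r+N_a$, followed by the $\sum_m\beta_mu(\boldsymbol x_{n-m})$, $M\le n\le N_1$. Put $\kappa_2(A_h)=\|A_h\|_2\|A_h^{-1}\|_2$ and $|g|_{2,h}=\bigl(\frac1\tau\sum_{n=r}^q|g(\boldsymbol x_n)|^2\bigr)^{1/2}$. \textbf{Networks.} For $k,G,N\ge1$ let $\mathcal{NN}(k,G,N)$ be the set of functions $$u(x)=\sum_{j=1}^N\phi_{1,j}\Bigl(\sum_{i=1}^d\phi_{0,j,i}\bigl(\tfrac{x_i+R}{2R}\bigr)\Bigr),$$ where every $\phi_{1,j}$, $\phi_{0,j,i}$ is a linear combination of the $G+k$ B-splines of degree $k$ on the uniform knots $(l-k)/G$, $0\le l\le G+2k$. Let $$E(k,G,N)=\inf_{u\in\mathcal{NN}(k,G,N)}\sup_{\Delta'}|u-f|,\qquad e_{\mathcal{NN}}(k,G,N)=2RN(L_Gd+1)\,\omega_f\Bigl(\min\Bigl\{\tfrac1{\sqrt{2k-2}},\sqrt{\tfrac k{12}}\,\tfrac1G\Bigr\}\Bigr),$$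 where $1/\sqrt{2k-2}=+\infty$ for $k=1$, and $L_G$ (which may depend on $k,G,N$) is the infimum of all $L\ge0$ for which some network in $\mathcal{NN}(k,G,N)$ whose outer functions $\phi_{1,j}$ are $L$-Lipschitz on $[0,1]$ approximates $f$ on $\Delta'$ with error at most $2RN(Ld+1)\,\omega_f(\min\{\frac1{\sqrt{2k-2}},\sqrt{\frac k{12}}\frac1G\})$. \textbf{Theorem.} (1) $E(k,G,N)\le e_{\mathcal{NN}}(k,G,N)$ for all $k,G,N\ge1$. (2) There is a constant $C>0$, independent of $h,k,G,N$, such that every global minimizer $f_{\mathcal{NN}}$ of $J_{a,h}$ over $\mathcal{NN}(k,G,N)$ satisfies $$|f_{\mathcal{NN}}-f|_{2,h}<C\,\kappa_2(A_h)\bigl(h^p+E(k,G,N)\bigr)\quad\text{and}\quad|f_{\mathcal{NN}}-f|_{2,h}<C\,\kappa_2(A_h)\bigl(h^p+e_{\mathcal{NN}}(k,G,N)\bigr).$$ (3) If $\kappa_2(A_h)$ is bounded uniformly in $h$, then $|f_{\mathcal{NN}}-f|_{2,h}\to0$ as $k,G,N\to\infty$ and $h\to0$, uniformly over all choices of the global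 minimizers $f_{\mathcal{NN}}$. -/

import Mathlib

open Set
open scoped ContDiff

noncomputable section

namespace KANLMM

/-! ### Two-layer B-spline Kolmogorov-Arnold networks -/

/-- The B-spline basis function `B_{i,k}` on the knots `t`, by the Cox-de Boor recurrence
(first explicit argument after the knots: the degree; second: the index). -/
def bspline (t : ℕ → ℝ) : ℕ → ℕ → ℝ → ℝ
  | 0, i, x => if t i ≤ x ∧ x < t (i + 1) then 1 else 0
  | k + 1, i, x =>
      (x - t i) / (t (i + k + 1) - t i) * bspline t k i x
        + (t (i + k + 2) - x) / (t (i + k + 2) - t (i + 1)) * bspline t k (i + 1) x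

/-- Uniform knots of mesh width `1 / G`, dividing `[0,1]` into `G` pieces and extended by `k`
knots on each side (the knots used are those with index `0, …, G + 2k`). -/
def knots (k G : ℕ) (i : ℕ) : ℝ := ((i : ℝ) - k) / G

/-- The B-spline activation function `∑_{q=0}^{G+k-1} c_q B_{q,k}` on `[0,1]`. -/
def activation (k G : ℕ) (c : Fin (G + k) → ℝ) (s : ℝ) : ℝ :=
  ∑ q : Fin (G + k), c q * bspline (knots k G) k q s

/-- The trainable coefficients of a two-layer B-spline KAN with `d` inputs and `N` outer
activation functions. -/
structure Params (d k G N : ℕ) where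
  /-- coefficients of the inner activation functions `φ_{0,j,i}` -/
  inner : Fin N → Fin d → Fin (G + k) → ℝ
  /-- coefficients of the outer activation functions `φ_{1,j}` -/
  outer : Fin N → Fin (G + k) → ℝ

/-- The function on `[-R,R]^d` computed by the network:
`∑_j φ_{1,j} (∑_i φ_{0,j,i} ((x_i + R) / (2R)))`. -/
def Params.eval {d k G N : ℕ} (R : ℝ) (θ : Params d k G N) (x : EuclideanSpace ℝ (Fin d)) : ℝ :=
  ∑ j : Fin N, activation k G (θ.outer j)
    (∑ i : Fin d, activation k G (θ.inner j i) ((x i + R) / (2 * R)))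

/-- The class `NN(k, G, N)` of two-layer B-spline KANs on `[-R,R]^d`. -/
def kanClass (d : ℕ) (R : ℝ) (k G N : ℕ) : Set (EuclideanSpace ℝ (Fin d) → ℝ) :=
  range fun θ : Params d k G N => θ.eval R

/-- The modulus of continuity `ω_g^S(r)`. -/
def modulus {d : ℕ} (g : EuclideanSpace ℝ (Fin d) → ℝ) (S : Set (EuclideanSpace ℝ (Fin d)))
    (r : ℝ) : ℝ :=
  sSup {s : ℝ | ∃ y ∈ S, ∃ z ∈ S, ‖y - z‖ ≤ r ∧ s = |g y - g z|}

/-- `min {1 / √(2k-2), √(k/12) / G}`, where the first entry is `+∞` for `k = 1`. -/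
def splineScale (k G : ℕ) : ℝ :=
  if k ≤ 1 then √((k : ℝ) / 12) * (1 / G)
  else min (1 / √(2 * (k : ℝ) - 2)) (√((k : ℝ) / 12) * (1 / G))

/-- The error of best uniform approximation of `g` on `S` by `NN(k, G, N)`. -/
def bestError {d : ℕ} (g : EuclideanSpace ℝ (Fin d) → ℝ) (S : Set (EuclideanSpace ℝ (Fin d)))
    (R : ℝ) (k G N : ℕ) : ℝ :=
  sInf {e : ℝ | 0 ≤ e ∧ ∃ u ∈ kanClass d R k G N, ∀ y ∈ S, |u y - g y| ≤ e}

/-- The expression `2 R N (L d + 1) ω_g(min {1 / √(2k-2), √(k/12) / G})`. -/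
def kanBound {d : ℕ} (g : EuclideanSpace ℝ (Fin d) → ℝ) (S : Set (EuclideanSpace ℝ (Fin d)))
    (R : ℝ) (k G N : ℕ) (L : ℝ) : ℝ :=
  2 * R * N * (L * d + 1) * modulus g S (splineScale k G)

/-- The constant `L_G`: the least `L` such that some network in `NN(k, G, N)`, with outer
activation functions that are `L`-Lipschitz on their grid interval `[0,1]`, approximates `g`
on `S` to within `2 R N (L d + 1) ω_g(min {1 / √(2k-2), √(k/12) / G})`. -/
def lipConst {d : ℕ} (g : EuclideanSpace ℝ (Fin d) → ℝ) (S : Set (EuclideanSpace ℝ (Fin d)))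
    (R : ℝ) (k G N : ℕ) : ℝ :=
  sInf {L : ℝ | 0 ≤ L ∧ ∃ θ : Params d k G N,
    (∀ j, LipschitzOnWith L.toNNReal (activation k G (θ.outer j)) (Icc 0 1)) ∧
    ∀ y ∈ S, |θ.eval R y - g y| ≤ kanBound g S R k G N L}

/-- `e_NN(k, G, N) = 2 R N (L_G d + 1) ω_g(min {1 / √(2k-2), √(k/12) / G})`. -/
def kanError {d : ℕ} (g : EuclideanSpace ℝ (Fin d) → ℝ) (S : Set (EuclideanSpace ℝ (Fin d)))
    (R : ℝ) (k G N : ℕ) : ℝ :=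
  kanBound g S R k G N (lipConst g S R k G N)

/-! ### Linear multistep methods -/

/-- An `M`-step linear multistep method
`∑_{m ≤ M} α_m x_{n-m} = h ∑_{m ≤ M} β_m f(x_{n-m})`; only `α_m, β_m` with `m ≤ M` are used. -/
structure LMM (M : ℕ) where
  α : ℕ → ℝ
  β : ℕ → ℝ
  steps_pos : 1 ≤ M
  α_zero_ne : α 0 ≠ 0
  β_ne : ∃ m ≤ M, β m ≠ 0

/-- The grid point `t_n = n h` with `h = T / N₁`. -/
def gridPt (T : ℝ) (N₁ n : ℕ) : ℝ := n * (T / N₁)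

namespace LMM

variable {M : ℕ}

/-- The local truncation error of the method at step `n`, along `x`. -/
def truncError (P : LMM M) {d : ℕ} (f : EuclideanSpace ℝ (Fin d) → EuclideanSpace ℝ (Fin d))
    (x : ℝ → EuclideanSpace ℝ (Fin d)) (T : ℝ) (N₁ n : ℕ) : EuclideanSpace ℝ (Fin d) :=
  (1 / (T / N₁)) • ∑ m ∈ Finset.range (M + 1), P.α m • x (gridPt T N₁ (n - m))
    - ∑ m ∈ Finset.range (M + 1), P.β m • f (x (gridPt T N₁ (n - m)))

/-- The method has order `p`: along every smooth solution of every autonomous system the local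
truncation error is `O(h^p)`, uniformly in the time step. -/
def HasOrder (P : LMM M) (p : ℕ) : Prop :=
  ∀ (d : ℕ) (f : EuclideanSpace ℝ (Fin d) → EuclideanSpace ℝ (Fin d))
    (x : ℝ → EuclideanSpace ℝ (Fin d)) (T : ℝ), 0 < T →
    ContDiffOn ℝ ∞ x (Icc 0 T) →
    (∀ t ∈ Icc 0 T, HasDerivWithinAt x (f (x t)) (Icc 0 T) t) →
    ∃ C : ℝ, ∀ N₁ n : ℕ, M ≤ n → n ≤ N₁ → ‖P.truncError f x T N₁ n‖ ≤ C * (T / N₁) ^ p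

/-- The smallest lag `m` with `β_m ≠ 0`. -/
def minLag (P : LMM M) : ℕ := sInf {m : ℕ | m ≤ M ∧ P.β m ≠ 0}

/-- The largest lag `m` with `β_m ≠ 0`. -/
def maxLag (P : LMM M) : ℕ := sSup {m : ℕ | m ≤ M ∧ P.β m ≠ 0}

/-- The first index `r` for which `f_r` occurs in the scheme. -/
def firstIdx (P : LMM M) : ℕ := M - P.maxLag

/-- The last index `q` for which `f_q` occurs in the scheme. -/
def lastIdx (P : LMM M) (N₁ : ℕ) : ℕ := N₁ - P.minLag

/-- The number `τ = q - r + 1` of unknowns `f_r, …, f_q`. -/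
def numUnknowns (P : LMM M) (N₁ : ℕ) : ℕ := P.lastIdx N₁ + 1 - P.firstIdx

/-- The number of auxiliary conditions: unknowns minus the `N₁ - M + 1` equations. -/
def numAux (P : LMM M) (N₁ : ℕ) : ℕ := P.numUnknowns N₁ - (N₁ + 1 - M)

/-- The matrix `A_h` of the augmented system: the first rows are those of the identity matrix,
and the remaining ones contain the coefficients of `f_r, …, f_q` in the equations
`n = M, …, N₁` of the scheme. -/
def augMatrix (P : LMM M) (N₁ : ℕ) :
    Matrix (Fin (P.numUnknowns N₁)) (Fin (P.numUnknowns N₁)) ℝ :=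
  fun i j =>
    if (i : ℕ) < P.numAux N₁ then (if i = j then 1 else 0)
    else
      let n : ℕ := M + (i - P.numAux N₁)
      let l : ℕ := P.firstIdx + j
      if l ≤ n ∧ n - l ≤ M then P.β (n - l) else 0

/-- The spectral condition number `κ₂(A_h) = ‖A_h‖₂ ‖A_h⁻¹‖₂`. -/
def cond (P : LMM M) (N₁ : ℕ) : ℝ :=
  ‖Matrix.toEuclideanCLM (𝕜 := ℝ) (P.augMatrix N₁)‖
    * ‖Matrix.toEuclideanCLM (𝕜 := ℝ) (P.augMatrix N₁)⁻¹‖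

/-- The augmented loss `J_{a,h}` for the component `i` of the system, from the states
`x_n = x(t_n)`, with finite difference coefficients `μ_0, …, μ_p`. -/
def loss (P : LMM M) {d : ℕ} (p : ℕ) (μ : ℕ → ℝ) (x : ℝ → EuclideanSpace ℝ (Fin d))
    (i : Fin d) (T : ℝ) (N₁ : ℕ) (u : EuclideanSpace ℝ (Fin d) → ℝ) : ℝ :=
  1 / (P.numUnknowns N₁ : ℝ) *
    ((∑ n ∈ Finset.Ico P.firstIdx (P.firstIdx + P.numAux N₁),
        |u (x (gridPt T N₁ n))
          - 1 / (T / N₁) * ∑ m ∈ Finset.range (p + 1), μ m * x (gridPt T N₁ (n + m)) i| ^ 2)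
      + ∑ n ∈ Finset.Icc M N₁,
        |(∑ m ∈ Finset.range (M + 1), P.β m * u (x (gridPt T N₁ (n - m))))
          - ∑ m ∈ Finset.range (M + 1),
              (T / N₁)⁻¹ * P.α m * x (gridPt T N₁ (n - m)) i| ^ 2)

/-- The LMM-related seminorm `|g|_{2,h} = (τ⁻¹ ∑_{n=r}^{q} |g(x_n)|²)^{1/2}`. -/
def seminorm (P : LMM M) {d : ℕ} (x : ℝ → EuclideanSpace ℝ (Fin d)) (T : ℝ) (N₁ : ℕ)
    (g : EuclideanSpace ℝ (Fin d) → ℝ) : ℝ :=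
  √(1 / (P.numUnknowns N₁ : ℝ) *
    ∑ n ∈ Finset.Icc P.firstIdx (P.lastIdx N₁), |g (x (gridPt T N₁ n))| ^ 2)

/-- `u` is a global minimizer of `J_{a,h}` over `NN(k, G, N)`. -/
def IsGlobalMinimizer (P : LMM M) {d : ℕ} (p : ℕ) (μ : ℕ → ℝ)
    (x : ℝ → EuclideanSpace ℝ (Fin d)) (i : Fin d) (T R : ℝ) (N₁ k G N : ℕ)
    (u : EuclideanSpace ℝ (Fin d) → ℝ) : Prop :=
  u ∈ kanClass d R k G N ∧ IsMinOn (P.loss p μ x i T N₁) (kanClass d R k G N) u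

/-- The grid is fine enough for the augmented loss to make sense: there is at least one equation,
and the auxiliary conditions only involve states with index at most `N₁`. -/
def Admissible (P : LMM M) (p N₁ : ℕ) : Prop :=
  M ≤ N₁ ∧ ∀ n < P.numAux N₁, P.firstIdx + n + p ≤ N₁

end LMM

/-- The forward difference quotient `h⁻¹ ∑_{m ≤ p} μ_m y(t + m h)` approximates `y'(t)` with
order `p` for smooth `y`. -/
def IsFiniteDifferenceOfOrder (p : ℕ) (μ : ℕ → ℝ) : Prop :=
  ∀ (y : ℝ → ℝ) (T : ℝ), 0 < T → ContDiffOn ℝ ∞ y (Icc 0 T) →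
    ∃ C : ℝ, ∀ h t : ℝ, 0 < h → 0 ≤ t → t + p * h ≤ T →
      |1 / h * ∑ m ∈ Finset.range (p + 1), μ m * y (t + m * h)
        - derivWithin y (Icc 0 T) t| ≤ C * h ^ p

end KANLMM

end

open KANLMM

/-! Bound of `bestError` by `kanError`. Every `L` admissible in the definition of `lipConst` comes
with a network whose error is at most `kanBound` at `L`. Since `kanBound` is continuous in `L`, the
bound passes to the infimum. Admissible `L` exist: if the modulus at the spline scale is positive,
the zero network works for large `L`; if it vanishes, `f` is constant on the connected set `S` and a
constant network works with `L = 0`.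

Error estimate. The loss is the squared residual of a square linear system for the values of `u` at
the states. Its matrix is lower triangular with diagonal entries `1` or `β` at the smallest active
lag, hence invertible, and `f` solves the system up to `O(h^p)`. A minimizer has no larger residual
than any competitor `w`; inserting `f` and inverting the matrix gives `seminorm_sub_le`, and the
infimum over `w` produces `bestError`.

Convergence. It remains to see that `bestError` tends to `0`. By Marsden's identity the splines of
degree `k` reproduce polynomials of degree at most `k` on `[0,1]`, so networks contain polynomial
ridge functions. These approximate the exponentials of linear forms, whose span is a
point-separating algebra, and Stone-Weierstrass applies on the compact closure of `S`. -/

namespace KANLMM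

/-! ### B-splines and polynomial reproduction. -/

section BSpline

open Polynomial

theorem bspline_eq_zero {t : ℕ → ℝ} (ht : StrictMono t) :
    ∀ (k i : ℕ) (x : ℝ), (x < t i ∨ t (i + k + 1) ≤ x) → bspline t k i x = 0
  | 0, i, x, h => by
    rw [bspline, if_neg]
    rintro ⟨h1, h2⟩
    rcases h with h | h
    · exact absurd h1 (not_le.2 h)
    · exact absurd h2 (not_lt.2 h)
  | k + 1, i, x, h => by
    have h1 : bspline t k i x = 0 := bspline_eq_zero ht k i x <| h.imp_right fun h =>
      (ht.monotone (by omega)).trans h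
    have h2 : bspline t k (i + 1) x = 0 := bspline_eq_zero ht k (i + 1) x <| h.imp
      (fun h => h.trans (ht (by omega))) fun h => (ht.monotone (by omega)).trans h
    rw [bspline, h1, h2, mul_zero, mul_zero, add_zero]

/-- This fails in degree `0`, where the value is `1`. It is needed at the right endpoint of `[0,1]`,
which the half-open intervals of degree `0` exclude. -/
theorem bspline_succ_left_knot {t : ℕ → ℝ} (ht : StrictMono t) (k i : ℕ) :
    bspline t (k + 1) i (t i) = 0 := by
  rw [bspline, bspline_eq_zero ht k (i + 1) (t i) (Or.inl (ht (by omega)))]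
  simp

/-- Marsden's identity. -/
theorem marsden {t : ℕ → ℝ} (ht : StrictMono t) (m : ℕ) {x : ℝ} (hm : x < t m) :
    ∀ k : ℕ, t k ≤ x →
      ∑ i ∈ Finset.range m, C (bspline t k i x) * ∏ j ∈ Finset.range k, (X - C (t (i + 1 + j)))
        = (X - C x) ^ k
  | 0, hk => by
    -- In degree `0` the sum telescopes as a difference of indicators.
    have h : ∀ i, bspline t 0 i x = (if x < t (i + 1) then 1 else 0) - if x < t i then 1 else 0 := by
      intro i
      have := ht (Nat.lt_succ_self i)
      rw [bspline]
      split_ifs <;> grind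
    simp only [Finset.range_zero, Finset.prod_empty, mul_one, pow_zero]
    rw [← map_sum, Finset.sum_congr rfl fun i _ => h i,
      Finset.sum_range_sub (fun i => if x < t i then (1 : ℝ) else 0), if_pos hm,
      if_neg (not_lt.2 hk)]
    simp
  | k + 1, hk => by
    -- The two terms of the recurrence become `a i` and `b (i + 1)`. Both `b 0` and `b m` vanish by
    -- the support property, so shifting the index pairs `a i` with `b i`, which share all but one
    -- linear factor.
    set a : ℕ → ℝ[X] := fun i => C ((x - t i) / (t (i + k + 1) - t i) * bspline t k i x) *
      ∏ j ∈ Finset.range (k + 1), (X - C (t (i + 1 + j))) with ha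
    set b : ℕ → ℝ[X] := fun i => C ((t (i + k + 1) - x) / (t (i + k + 1) - t i) * bspline t k i x) *
      ∏ j ∈ Finset.range (k + 1), (X - C (t (i + j))) with hb
    have h1 : ∀ i, C (bspline t (k + 1) i x) *
        ∏ j ∈ Finset.range (k + 1), (X - C (t (i + 1 + j))) = a i + b (i + 1) := by
      intro i
      simp only [ha, hb]
      rw [bspline, C_add, add_mul, show i + 1 + k + 1 = i + k + 2 by omega]
    have h2 : ∀ i, a i + b i = (C (bspline t k i x) *
        ∏ j ∈ Finset.range k, (X - C (t (i + 1 + j)))) * (X - C x) := by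
      intro i
      have hne : t (i + k + 1) - t i ≠ 0 := (sub_pos.2 (ht (by omega))).ne'
      simp only [ha, hb]
      rw [Finset.prod_range_succ, Finset.prod_range_succ', add_zero,
        show i + 1 + k = i + k + 1 by omega]
      have e0 : ∏ j ∈ Finset.range k, (X - C (t (i + (j + 1))))
          = ∏ j ∈ Finset.range k, (X - C (t (i + 1 + j))) :=
        Finset.prod_congr rfl fun j _ => by congr 3; omega
      rw [e0]
      -- The weights sum to `1` and average the knots `t (i + k + 1)` and `t i` to `x`, so the two
      -- unshared factors combine to `X - C x`.
      have e1 : (x - t i) / (t (i + k + 1) - t i) + (t (i + k + 1) - x) / (t (i + k + 1) - t i)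
          = 1 := by field_simp; ring
      have e2 : (x - t i) / (t (i + k + 1) - t i) * t (i + k + 1)
          + (t (i + k + 1) - x) / (t (i + k + 1) - t i) * t i = x := by field_simp; ring
      have e1' := congrArg (C : ℝ →+* ℝ[X]) e1
      have e2' := congrArg (C : ℝ →+* ℝ[X]) e2
      simp only [C_add, C_mul, C_1] at e1' e2' ⊢
      linear_combination (C (bspline t k i x) * ∏ j ∈ Finset.range k, (X - C (t (i + 1 + j))))
        * (X * e1' - e2')
    have hb0 : b 0 = 0 := by
      simp only [hb]
      rw [bspline_eq_zero ht k 0 x (Or.inr (by simpa using hk))]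
      simp
    have hbm : b m = 0 := by
      simp only [hb]
      rw [bspline_eq_zero ht k m x (Or.inl hm)]
      simp
    have h3 : ∑ i ∈ Finset.range m, b (i + 1) = ∑ i ∈ Finset.range m, b i := by
      have h := Finset.sum_range_succ b m
      rw [Finset.sum_range_succ', hb0, hbm] at h
      simpa using h
    rw [Finset.sum_congr rfl fun i _ => h1 i, Finset.sum_add_distrib, h3, ← Finset.sum_add_distrib,
      Finset.sum_congr rfl fun i _ => h2 i, ← Finset.sum_mul,
      marsden ht m hm k ((ht (Nat.lt_succ_self k)).le.trans hk), pow_succ]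

theorem knots_strictMono (k : ℕ) {G : ℕ} (hG : 1 ≤ G) : StrictMono (knots k G) := by
  intro i j hij
  have : (0 : ℝ) < G := by exact_mod_cast hG
  have : (i : ℝ) < j := by exact_mod_cast hij
  unfold knots
  gcongr

theorem marsden_knots {k G : ℕ} (hk : 1 ≤ k) (hG : 1 ≤ G) {s : ℝ} (hs : s ∈ Icc (0 : ℝ) 1) :
    ∑ q ∈ Finset.range (G + k), C (bspline (knots k G) k q s) *
      ∏ j ∈ Finset.range k, (X - C (knots k G (q + 1 + j))) = (X - C s) ^ k := by
  have hmono := knots_strictMono k hG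
  have hG0 : (G : ℝ) ≠ 0 := by positivity
  have h0 : knots k G k = 0 := by simp [knots]
  have h1 : knots k G (G + k) = 1 := by simp [knots, hG0]
  rcases hs.2.lt_or_eq with h | h
  · exact marsden hmono _ (by rwa [h1]) k (by rw [h0]; exact hs.1)
  -- At `s = 1` the identity needs one more B-spline than the class provides; the extra one has its
  -- left knot at `1` and vanishes there.
  · have := marsden hmono (G + k + 1) (x := s)
      (by rw [h, ← h1]; exact hmono (by omega)) k (by rw [h0]; exact hs.1)
    rw [Finset.sum_range_succ] at this
    obtain ⟨l, rfl⟩ : ∃ l, k = l + 1 := ⟨k - 1, by omega⟩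
    rw [h, ← h1, bspline_succ_left_knot hmono, C_0, zero_mul, add_zero] at this
    rw [h, ← h1]
    exact this

/-- Compare coefficients of `X ^ (k - m)` in Marsden's identity: on the right it is a nonzero
multiple of `s ^ m`, on the left a spline in `s`. -/
theorem exists_activation_eq_pow {k G : ℕ} (hk : 1 ≤ k) (hG : 1 ≤ G) {m : ℕ} (hm : m ≤ k) :
    ∃ c : Fin (G + k) → ℝ, ∀ s ∈ Icc (0 : ℝ) 1, activation k G c s = s ^ m := by
  refine ⟨fun q => (-1) ^ m * ((k.choose (k - m) : ℕ) : ℝ)⁻¹ *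
    (∏ j ∈ Finset.range k, (X - C (knots k G (q + 1 + j)))).coeff (k - m), fun s hs => ?_⟩
  have h := congrArg (fun P => coeff P (k - m)) (marsden_knots hk hG hs)
  simp only [finsetSum_coeff, coeff_C_mul, sub_eq_add_neg X (C s), ← C_neg, coeff_X_add_C_pow, Nat.sub_sub_self hm] at h
  have hne : ((k.choose (k - m) : ℕ) : ℝ) ≠ 0 := by
    exact_mod_cast (Nat.choose_pos (Nat.sub_le k m)).ne'
  rw [Finset.sum_range] at h
  unfold activation
  calc _ = (-1) ^ m * ((k.choose (k - m) : ℕ) : ℝ)⁻¹ * ∑ q : Fin (G + k),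
      bspline (knots k G) k q s *
        (∏ j ∈ Finset.range k, (X - C (knots k G (q + 1 + j)))).coeff (k - m) := by
        rw [Finset.mul_sum]
        exact Finset.sum_congr rfl fun q _ => by ring
    _ = s ^ m := by
        rw [h, neg_pow s, show (-1 : ℝ) ^ m * ((k.choose (k - m) : ℕ) : ℝ)⁻¹ *
          ((-1) ^ m * s ^ m * ((k.choose (k - m) : ℕ) : ℝ)) = ((-1) ^ m * (-1) ^ m) * s ^ m *
          (((k.choose (k - m) : ℕ) : ℝ)⁻¹ * ((k.choose (k - m) : ℕ) : ℝ)) by ring,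
          inv_mul_cancel₀ hne, ← mul_pow]
        norm_num

/-- On `[0,1]` the B-spline activations of degree `k` include all polynomials of degree at most
`k`. -/
theorem exists_activation_eq_eval {k G : ℕ} (hk : 1 ≤ k) (hG : 1 ≤ G) (Q : ℝ[X])
    (hQ : Q.natDegree ≤ k) :
    ∃ c : Fin (G + k) → ℝ, ∀ s ∈ Icc (0 : ℝ) 1, activation k G c s = Q.eval s := by
  choose! c hc using fun m (hm : m ≤ k) => exists_activation_eq_pow hk hG hm
  refine ⟨fun q => ∑ m ∈ Finset.range (k + 1), Q.coeff m * c m q, fun s hs => ?_⟩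
  rw [eval_eq_sum_range' (Nat.lt_succ_of_le hQ)]
  simp only [activation, Finset.sum_mul]
  rw [Finset.sum_comm]
  refine Finset.sum_congr rfl fun m hm => ?_
  rw [← hc m (Nat.le_of_lt_succ (Finset.mem_range.1 hm)) s hs, activation, Finset.mul_sum]
  exact Finset.sum_congr rfl fun q _ => by ring

end BSpline

/-! ### Density of the networks in the continuous functions. -/

section Class

open Polynomial

variable {d : ℕ} {R : ℝ} {k G : ℕ}

theorem activation_smul (c : Fin (G + k) → ℝ) (a s : ℝ) :
    activation k G (a • c) s = a * activation k G c s := by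
  simp only [activation, Finset.mul_sum, Pi.smul_apply, smul_eq_mul, mul_assoc]

theorem zero_mem_kanClass (d : ℕ) (R : ℝ) (k G N : ℕ) :
    (0 : EuclideanSpace ℝ (Fin d) → ℝ) ∈ kanClass d R k G N :=
  ⟨⟨0, 0⟩, by funext x; simp [Params.eval, activation]⟩

theorem smul_mem_kanClass {N : ℕ} {u : EuclideanSpace ℝ (Fin d) → ℝ}
    (hu : u ∈ kanClass d R k G N) (a : ℝ) : a • u ∈ kanClass d R k G N := by
  obtain ⟨θ, rfl⟩ := hu
  refine ⟨⟨θ.inner, fun j => a • θ.outer j⟩, ?_⟩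
  funext x
  simp only [Params.eval, activation_smul, Pi.smul_apply, smul_eq_mul, Finset.mul_sum]

theorem add_mem_kanClass {N₁ N₂ : ℕ} {u v : EuclideanSpace ℝ (Fin d) → ℝ}
    (hu : u ∈ kanClass d R k G N₁) (hv : v ∈ kanClass d R k G N₂) :
    u + v ∈ kanClass d R k G (N₁ + N₂) := by
  obtain ⟨θ, rfl⟩ := hu
  obtain ⟨η, rfl⟩ := hv
  refine ⟨⟨Fin.append θ.inner η.inner, Fin.append θ.outer η.outer⟩, ?_⟩
  funext x
  simp [Params.eval, Fin.sum_univ_add]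

theorem scaled_mem_Icc (hR : 0 < R) {a : ℝ} (ha : |a| ≤ R) : (a + R) / (2 * R) ∈ Icc (0 : ℝ) 1 := by
  have := abs_le.1 ha
  constructor
  · apply div_nonneg <;> linarith
  · rw [div_le_one (by linarith)]; linarith

/-- A polynomial ridge function is computed on the cube by a network with any number of outer
functions. -/
theorem exists_mem_kanClass_eq_ridge (hR : 0 < R) (hk : 1 ≤ k) (hG : 1 ≤ G) {N : ℕ} (hN : 1 ≤ N)
    (a : Fin d → ℝ) (Q : ℝ[X]) (hQ : Q.natDegree ≤ k) {W : ℝ} (hW : 0 < W)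
    (haW : ∑ l, |a l| * R ≤ W) :
    ∃ u ∈ kanClass d R k G N, ∀ y : EuclideanSpace ℝ (Fin d), (∀ l, |y l| ≤ R) →
      u y = Q.eval ((∑ l, a l * y l + ∑ l, |a l| * R) / (2 * W)) := by
  -- All `N` outer summands are the same, so each carries `Q / N`.
  obtain ⟨c, hc⟩ := exists_activation_eq_eval hk hG (C ((N : ℝ)⁻¹) * Q)
    ((natDegree_C_mul_le _ _).trans hQ)
  -- Each inner function equals `(a l * y l + |a l| * R) / (2 * W)` in the original variable. The
  -- shift makes the inner sum land in `[0,1]`, the only place where the outer spline is known to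
  -- equal its polynomial.
  choose b hb using fun l => exists_activation_eq_eval hk hG
    (C (a l * R / W) * X + C ((|a l| - a l) * R / (2 * W)))
    (natDegree_linear_le.trans hk)
  refine ⟨_, ⟨⟨fun _ => b, fun _ => c⟩, rfl⟩, fun y hy => ?_⟩
  have hsum : ∑ l, activation k G (b l) ((y l + R) / (2 * R))
      = (∑ l, a l * y l + ∑ l, |a l| * R) / (2 * W) := by
    rw [← Finset.sum_add_distrib, Finset.sum_div]
    refine Finset.sum_congr rfl fun l _ => ?_
    rw [hb l _ (scaled_mem_Icc hR (hy l))]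
    simp only [eval_add, eval_mul, eval_C, eval_X]
    field_simp
    ring
  have hle : |∑ l, a l * y l| ≤ ∑ l, |a l| * R := by
    refine (Finset.abs_sum_le_sum_abs _ _).trans (Finset.sum_le_sum fun l _ => ?_)
    rw [abs_mul]
    exact mul_le_mul_of_nonneg_left (hy l) (abs_nonneg _)
  have hmem : (∑ l, a l * y l + ∑ l, |a l| * R) / (2 * W) ∈ Icc (0 : ℝ) 1 := by
    have := abs_le.1 hle
    constructor
    · apply div_nonneg <;> linarith
    · rw [div_le_one (by linarith)]; linarith
  have hN0 : (N : ℝ) ≠ 0 := by positivity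
  simp only [Params.eval, hsum]
  rw [hc _ hmem]
  simp [hN0]

/-- `g` can be approximated on `K` by all networks with sufficiently large parameters. -/
def Approximable (R : ℝ) (K : Set (EuclideanSpace ℝ (Fin d))) (g : EuclideanSpace ℝ (Fin d) → ℝ) :
    Prop :=
  ∀ ε > 0, ∃ K₀ : ℕ, ∀ k G N : ℕ, K₀ ≤ k → K₀ ≤ G → K₀ ≤ N →
    ∃ u ∈ kanClass d R k G N, ∀ y ∈ K, |u y - g y| ≤ ε

variable {K : Set (EuclideanSpace ℝ (Fin d))} {g g' : EuclideanSpace ℝ (Fin d) → ℝ}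

theorem Approximable.add (h : Approximable R K g) (h' : Approximable R K g') :
    Approximable R K (g + g') := by
  intro ε hε
  obtain ⟨K₁, h₁⟩ := h (ε / 2) (by linarith)
  obtain ⟨K₂, h₂⟩ := h' (ε / 2) (by linarith)
  refine ⟨K₁ + K₂, fun k G N hk hG hN => ?_⟩
  -- The first summand gets a fixed number of outer functions and the second all the others, so
  -- every large `N` is reached exactly.
  obtain ⟨u, hu, hu'⟩ := h₁ k G K₁ (by omega) (by omega) le_rfl
  obtain ⟨v, hv, hv'⟩ := h₂ k G (N - K₁) (by omega) (by omega) (by omega)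
  have huv := add_mem_kanClass hu hv
  rw [show K₁ + (N - K₁) = N by omega] at huv
  refine ⟨u + v, huv, fun y hy => ?_⟩
  have h1 := hu' y hy
  have h2 := hv' y hy
  calc |(u + v) y - (g + g') y| = |(u y - g y) + (v y - g' y)| := by
        simp only [Pi.add_apply]; ring_nf
    _ ≤ ε := (abs_add_le _ _).trans (by linarith)

theorem Approximable.smul (h : Approximable R K g) (a : ℝ) : Approximable R K (a • g) := by
  intro ε hε
  have ha : 0 < |a| + 1 := by positivity
  obtain ⟨K₁, h₁⟩ := h (ε / (|a| + 1)) (by positivity)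
  refine ⟨K₁, fun k G N hk hG hN => ?_⟩
  obtain ⟨u, hu, hu'⟩ := h₁ k G N hk hG hN
  refine ⟨a • u, smul_mem_kanClass hu a, fun y hy => ?_⟩
  have h1 := hu' y hy
  rw [le_div_iff₀ ha] at h1
  simp only [Pi.smul_apply, smul_eq_mul, ← mul_sub, abs_mul]
  nlinarith [abs_nonneg (u y - g y)]

theorem Approximable.of_near
    (h : ∀ ε > 0, ∃ g', Approximable R K g' ∧ ∀ y ∈ K, |g' y - g y| ≤ ε) :
    Approximable R K g := by
  intro ε hε
  obtain ⟨g', hg', hn⟩ := h (ε / 2) (by linarith)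
  obtain ⟨K₁, h₁⟩ := hg' (ε / 2) (by linarith)
  refine ⟨K₁, fun k G N hk hG hN => ?_⟩
  obtain ⟨u, hu, hu'⟩ := h₁ k G N hk hG hN
  exact ⟨u, hu, fun y hy => (abs_sub_le _ (g' y) _).trans (by linarith [hu' y hy, hn y hy])⟩

theorem approximable_exp (hR : 0 < R) (hK : ∀ y ∈ K, ∀ l, |y l| ≤ R) (a : Fin d → ℝ) :
    Approximable R K fun y => Real.exp (∑ l, a l * y l) := by
  intro ε hε
  set A := ∑ l, |a l| * R with hA
  have hA0 : 0 ≤ A := Finset.sum_nonneg fun l _ => mul_nonneg (abs_nonneg _) hR.le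
  -- The affine map sends `[0,1]` onto `[-A, A + 2]`, which contains the range of the linear form;
  -- `A + 1` instead of `A` avoids division by zero when `a = 0`.
  obtain ⟨Q, hQ⟩ := exists_polynomial_near_of_continuousOn 0 1
    (fun z : ℝ => Real.exp (2 * (A + 1) * z - A)) (by fun_prop) ε hε
  refine ⟨Q.natDegree + 1, fun k G N hk hG hN => ?_⟩
  obtain ⟨u, hu, hu'⟩ := exists_mem_kanClass_eq_ridge (k := k) (G := G) (N := N) hR (by omega)
    (by omega) (by omega) a Q (by omega) (W := A + 1) (by linarith) (by linarith)
  refine ⟨u, hu, fun y hy => ?_⟩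
  have hle : |∑ l, a l * y l| ≤ A := by
    refine (Finset.abs_sum_le_sum_abs _ _).trans (Finset.sum_le_sum fun l _ => ?_)
    rw [abs_mul]
    exact mul_le_mul_of_nonneg_left (hK y hy l) (abs_nonneg _)
  have h := hQ ((∑ l, a l * y l + A) / (2 * (A + 1))) (by
    have := abs_le.1 hle
    constructor
    · apply div_nonneg <;> linarith
    · rw [div_le_one (by linarith)]; linarith)
  rw [mul_div_cancel₀ _ (by positivity : (2 * (A + 1)) ≠ 0), add_sub_cancel_right] at h
  rw [hu' y (hK y hy)]
  exact h.le

theorem approximable_of_continuousOn (hR : 0 < R) (hKc : IsCompact K)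
    (hK : ∀ y ∈ K, ∀ l, |y l| ≤ R) (hg : ContinuousOn g K) : Approximable R K g := by
  classical
  have : CompactSpace K := isCompact_iff_compactSpace.1 hKc
  let e : (Fin d → ℝ) → C(K, ℝ) := fun a =>
    ⟨fun y => Real.exp (∑ l, a l * (y : EuclideanSpace ℝ (Fin d)) l), by fun_prop⟩
  have he1 : e 0 = 1 := by ext y; simp [e]
  have hemul : ∀ a b, e a * e b = e (a + b) := by
    intro a b
    ext y
    simp [e, ← Real.exp_add, add_mul, Finset.sum_add_distrib]
  -- Exponentials are closed under products, so the algebra they generate is their linear span;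
  -- products of networks never arise.
  have hclos : ∀ φ ∈ Submonoid.closure (range e), φ ∈ range e := by
    intro φ hφ
    induction hφ using Submonoid.closure_induction with
    | mem φ h => exact h
    | one => exact ⟨0, he1⟩
    | mul φ ψ _ _ h h' =>
      obtain ⟨a, rfl⟩ := h
      obtain ⟨b, rfl⟩ := h'
      exact ⟨a + b, (hemul a b).symm⟩
  have happ : ∀ φ ∈ Algebra.adjoin ℝ (range e), ∃ g', Approximable R K g' ∧
      ∀ y : K, g' y = φ y := by
    intro φ hφ
    rw [← Subalgebra.mem_toSubmodule, Algebra.adjoin_eq_span] at hφ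
    induction hφ using Submodule.span_induction with
    | mem φ h =>
      obtain ⟨a, rfl⟩ := hclos φ h
      exact ⟨_, approximable_exp hR hK a, fun y => rfl⟩
    | zero =>
      exact ⟨0, fun ε hε => ⟨0, fun k G N _ _ _ => ⟨0, zero_mem_kanClass d R k G N,
        fun y _ => by simpa using hε.le⟩⟩, fun y => rfl⟩
    | add φ ψ _ _ h h' =>
      obtain ⟨g₁, h₁, h₁'⟩ := h
      obtain ⟨g₂, h₂, h₂'⟩ := h'
      exact ⟨g₁ + g₂, h₁.add h₂, fun y => by simp [h₁', h₂']⟩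
    | smul a φ _ h =>
      obtain ⟨g₁, h₁, h₁'⟩ := h
      exact ⟨a • g₁, h₁.smul a, fun y => by simp [h₁']⟩
  have hsep : (Algebra.adjoin ℝ (range e)).SeparatesPoints := by
    intro y z hyz
    obtain ⟨l, hl⟩ : ∃ l, (y : EuclideanSpace ℝ (Fin d)) l ≠ (z : EuclideanSpace ℝ (Fin d)) l := by
      by_contra! h
      exact hyz (Subtype.ext (PiLp.ext h))
    refine ⟨_, ⟨e (Pi.single l 1), Algebra.subset_adjoin ⟨_, rfl⟩, rfl⟩, ?_⟩
    simpa [e, Pi.single_apply] using hl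
  refine Approximable.of_near fun ε hε => ?_
  obtain ⟨φ, hφ⟩ := ContinuousMap.exists_mem_subalgebra_near_continuousMap_of_separatesPoints
    (Algebra.adjoin ℝ (range e)) hsep ⟨fun y : K => g y, continuousOn_iff_continuous_domRestrict.1 hg⟩ ε hε
  obtain ⟨g', hg', hg''⟩ := happ φ φ.2
  refine ⟨g', hg', fun y hy => ?_⟩
  have h := ((φ : C(K, ℝ)) - ⟨fun y : K => g y, continuousOn_iff_continuous_domRestrict.1 hg⟩).norm_coe_le_norm ⟨y, hy⟩
  have h' := hg'' ⟨y, hy⟩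
  simp only [ContinuousMap.sub_apply, ← h', Real.norm_eq_abs] at h
  exact h.trans hφ.le

end Class

/-! ### Best approximation error and the bound with the Lipschitz constant. -/

section Error

variable {d : ℕ} {R : ℝ} {S : Set (EuclideanSpace ℝ (Fin d))} {f : EuclideanSpace ℝ (Fin d) → ℝ}

theorem isCompact_closure_of_abs_le (hSR : ∀ y ∈ S, ∀ l, |y l| ≤ R) :
    IsCompact (closure S) ∧ ∀ y ∈ closure S, ∀ l, |y l| ≤ R := by
  have hcl : IsClosed {y : EuclideanSpace ℝ (Fin d) | ∀ l, |y l| ≤ R} := by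
    simp only [ofPred_forall]
    exact isClosed_iInter fun l => isClosed_le (by fun_prop) continuous_const
  refine ⟨Metric.isCompact_of_isClosed_isBounded isClosed_closure
    (Bornology.IsBounded.closure ?_), fun y hy => closure_minimal hSR hcl hy⟩
  refine isBounded_iff_forall_norm_le.2 ⟨√(∑ _l : Fin d, R ^ 2), fun y hy => ?_⟩
  rw [EuclideanSpace.norm_eq]
  refine Real.sqrt_le_sqrt (Finset.sum_le_sum fun l _ => ?_)
  exact pow_le_pow_left₀ (norm_nonneg _) (hSR y hy l) 2

/-- A uniformly continuous function extends continuously to the closure. -/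
theorem exists_continuousOn_closure (hf : UniformContinuousOn f S) :
    ∃ g : EuclideanSpace ℝ (Fin d) → ℝ, ContinuousOn g (closure S) ∧ EqOn g f S := by
  classical
  let e : S → closure S := inclusion subset_closure
  have he : IsUniformInducing e :=
    isUniformEmbedding_subtype_val.isUniformInducing.of_comp_iff.1
      isUniformEmbedding_subtype_val.isUniformInducing
  have hd : DenseRange e := (denseRange_inclusion_iff subset_closure).2 subset_rfl
  have hf' : UniformContinuous fun y : S => f y := uniformContinuousOn_iff_restrict.1 hf
  have hc := (uniformContinuous_uniformly_extend he hd hf').continuous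
  refine ⟨fun y => if h : y ∈ closure S then
    (he.isDenseInducing hd).extend (fun y : S => f y) ⟨y, h⟩ else 0, ?_, fun y hy => ?_⟩
  · rw [continuousOn_iff_continuous_domRestrict]
    refine hc.congr fun y => ?_
    rw [domRestrict_apply, dif_pos y.2]
  · simp only [dif_pos (subset_closure hy)]
    exact uniformly_extend_of_ind he hd hf' ⟨y, hy⟩

theorem exists_abs_le (hSR : ∀ y ∈ S, ∀ l, |y l| ≤ R) (hf : UniformContinuousOn f S) :
    ∃ B, 0 ≤ B ∧ ∀ y ∈ S, |f y| ≤ B := by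
  obtain ⟨g, hg, hgf⟩ := exists_continuousOn_closure hf
  obtain ⟨B, hB⟩ := (isCompact_closure_of_abs_le hSR).1.exists_bound_of_continuousOn hg
  refine ⟨max B 0, le_max_right _ _, fun y hy => ?_⟩
  rw [← hgf hy]
  exact (hB y (subset_closure hy)).trans (le_max_left _ _)

theorem approximable_of_uniformContinuousOn (hR : 0 < R) (hSR : ∀ y ∈ S, ∀ l, |y l| ≤ R)
    (hf : UniformContinuousOn f S) : Approximable R S f := by
  obtain ⟨g, hg, hgf⟩ := exists_continuousOn_closure hf
  obtain ⟨hc, hb⟩ := isCompact_closure_of_abs_le hSR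
  intro ε hε
  obtain ⟨K₀, h⟩ := approximable_of_continuousOn hR hc hb hg ε hε
  refine ⟨K₀, fun k G N hk hG hN => ?_⟩
  obtain ⟨u, hu, hu'⟩ := h k G N hk hG hN
  exact ⟨u, hu, fun y hy => by rw [← hgf hy]; exact hu' y (subset_closure hy)⟩

theorem bestError_le {k G N : ℕ} {e : ℝ} (he : 0 ≤ e) {u : EuclideanSpace ℝ (Fin d) → ℝ}
    (hu : u ∈ kanClass d R k G N) (h : ∀ y ∈ S, |u y - f y| ≤ e) : bestError f S R k G N ≤ e :=
  csInf_le ⟨0, fun _ h => h.1⟩ ⟨he, u, hu, h⟩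

theorem bestError_nonneg {k G N : ℕ} : 0 ≤ bestError f S R k G N :=
  Real.sInf_nonneg fun _ h => h.1

theorem modulus_nonneg {r : ℝ} : 0 ≤ modulus f S r :=
  Real.sSup_nonneg fun _ ⟨_, _, _, _, _, h⟩ => h ▸ abs_nonneg _

theorem splineScale_pos {k G : ℕ} (hk : 1 ≤ k) (hG : 1 ≤ G) : 0 < splineScale k G := by
  have hk' : (0 : ℝ) < k := by exact_mod_cast hk
  have hG' : (0 : ℝ) < G := by exact_mod_cast hG
  unfold splineScale
  split_ifs with h
  · positivity
  · have : (1 : ℝ) < k := by exact_mod_cast not_le.1 h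
    have : 0 < 2 * (k : ℝ) - 2 := by linarith
    apply lt_min <;> positivity

/-- A function with vanishing modulus of continuity at a positive scale is constant on connected
sets. -/
theorem eq_of_modulus_eq_zero (hconn : IsPreconnected S) {B : ℝ} (hB : ∀ y ∈ S, |f y| ≤ B)
    {r : ℝ} (hr : 0 < r) (h0 : modulus f S r = 0) {y z : EuclideanSpace ℝ (Fin d)} (hy : y ∈ S)
    (hz : z ∈ S) : f y = f z := by
  have hloc : ∀ y ∈ S, ∀ z ∈ S, dist y z < r → f y = f z := by
    intro y hy z hz hyz
    -- Without boundedness the supremum would be `0` by default and its vanishing would say nothing.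
    have hbdd : BddAbove {s : ℝ | ∃ y ∈ S, ∃ z ∈ S, ‖y - z‖ ≤ r ∧ s = |f y - f z|} := by
      refine ⟨B + B, ?_⟩
      rintro s ⟨y, hy, z, hz, -, rfl⟩
      exact (abs_sub _ _).trans (add_le_add (hB y hy) (hB z hz))
    have h : |f y - f z| ≤ modulus f S r :=
      le_csSup hbdd ⟨y, hy, z, hz, by rw [← dist_eq_norm]; exact hyz.le, rfl⟩
    rw [h0] at h
    exact sub_eq_zero.1 (abs_eq_zero.1 (le_antisymm h (abs_nonneg _)))
  have : PreconnectedSpace S := Subtype.preconnectedSpace hconn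
  have hlc : IsLocallyConstant fun y : S => f y := by
    rw [IsLocallyConstant.iff_eventually_eq]
    intro y
    filter_upwards [Metric.ball_mem_nhds y hr] with z hz
    exact hloc z z.2 y y.2 hz
  exact hlc.apply_eq_of_preconnectedSpace ⟨y, hy⟩ ⟨z, hz⟩

theorem bestError_le_kanError (hR : 0 < R) (hSR : ∀ y ∈ S, ∀ l, |y l| ≤ R) (hS : S.Nonempty)
    (hconn : IsPreconnected S) (hf : UniformContinuousOn f S) {k G N : ℕ} (hk : 1 ≤ k)
    (hG : 1 ≤ G) (hN : 1 ≤ N) (hd : 1 ≤ d) : bestError f S R k G N ≤ kanError f S R k G N := by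
  obtain ⟨B, hB0, hB⟩ := exists_abs_le hSR hf
  have hN' : (0 : ℝ) < N := by exact_mod_cast hN
  have hd' : (0 : ℝ) < d := by exact_mod_cast hd
  have hb : ∀ L, 0 ≤ L → 0 ≤ kanBound f S R k G N L := fun L hL =>
    mul_nonneg (by positivity) modulus_nonneg
  set A := {L : ℝ | 0 ≤ L ∧ ∃ θ : Params d k G N,
    (∀ j, LipschitzOnWith L.toNNReal (activation k G (θ.outer j)) (Icc 0 1)) ∧
    ∀ y ∈ S, |θ.eval R y - f y| ≤ kanBound f S R k G N L} with hA
  -- An empty set would give `lipConst` the default value `0`, with no network behind it.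
  have hne : A.Nonempty := by
    rcases (modulus_nonneg (f := f) (S := S) (r := splineScale k G)).eq_or_lt with h0 | hpos
    · obtain ⟨y₀, hy₀⟩ := hS
      obtain ⟨c, hc⟩ := exists_activation_eq_eval hk hG (Polynomial.C ((N : ℝ)⁻¹ * f y₀))
        (by rw [Polynomial.natDegree_C]; exact Nat.zero_le _)
      simp only [Polynomial.eval_C] at hc
      refine ⟨0, le_rfl, ⟨0, fun _ => c⟩, fun j => ?_, fun y hy => ?_⟩
      · intro a ha b hb
        simp [hc a ha, hc b hb]
      · have h1 : activation k G c 0 = (N : ℝ)⁻¹ * f y₀ := hc 0 (by simp)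
        have h2 : ∀ s, activation k G 0 s = 0 := fun s => by simp [activation]
        simp only [Params.eval, Pi.zero_apply, h2, Finset.sum_const_zero, h1]
        simp only [Finset.sum_const, Finset.card_univ, Fintype.card_fin, nsmul_eq_mul]
        rw [mul_inv_cancel_left₀ hN'.ne',
          eq_of_modulus_eq_zero hconn hB (splineScale_pos hk hG) h0.symm hy₀ hy, sub_self, abs_zero]
        exact hb 0 le_rfl
    · set m := 2 * R * N * d * modulus f S (splineScale k G) with hm
      have hm0 : 0 < m := by positivity
      -- With this `L` the part of `kanBound` linear in `L` is exactly `B`, the error bound of the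
      -- zero network.
      refine ⟨B / m, by positivity, ⟨0, 0⟩, fun j => ?_, fun y hy => ?_⟩
      · intro a ha b hb
        simp [activation]
      · have h1 : Params.eval R (⟨0, 0⟩ : Params d k G N) y = 0 := by
          simp [Params.eval, activation]
        rw [h1, zero_sub, abs_neg]
        refine (hB y hy).trans ?_
        have : kanBound f S R k G N (B / m) = B / m * m +
            2 * R * N * modulus f S (splineScale k G) := by
          rw [hm, kanBound]; ring
        rw [this, div_mul_cancel₀ _ hm0.ne']
        have : 0 ≤ 2 * R * N * modulus f S (splineScale k G) := by positivity
        linarith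
  have hmem : ∀ L ∈ A, bestError f S R k G N ≤ kanBound f S R k G N L := by
    rintro L ⟨hL, θ, -, h⟩
    exact bestError_le (hb L hL) ⟨θ, rfl⟩ h
  have hcont : Continuous (kanBound f S R k G N) := by unfold kanBound; fun_prop
  have hcl : IsClosed {L | bestError f S R k G N ≤ kanBound f S R k G N L} :=
    isClosed_le continuous_const hcont
  -- The infimum need not be attained, but it lies in the closure of `A`, and the inequality is
  -- closed in `L`.
  exact closure_minimal hmem hcl (csInf_mem_closure hne ⟨0, fun _ h => h.1⟩)

end Error

/-! ### The augmented linear system and its stability. -/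

namespace LMM

variable {M : ℕ} (P : LMM M)

theorem minLag_mem : P.minLag ≤ M ∧ P.β P.minLag ≠ 0 :=
  Nat.sInf_mem (s := {m : ℕ | m ≤ M ∧ P.β m ≠ 0}) P.β_ne

theorem minLag_le {m : ℕ} (hm : m ≤ M) (h : P.β m ≠ 0) : P.minLag ≤ m :=
  Nat.sInf_le ⟨hm, h⟩

theorem maxLag_le : P.maxLag ≤ M :=
  csSup_le' fun _ h => h.1

theorem le_maxLag {m : ℕ} (hm : m ≤ M) (h : P.β m ≠ 0) : m ≤ P.maxLag :=
  le_csSup ⟨M, fun _ h => h.1⟩ ⟨hm, h⟩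

theorem minLag_le_maxLag : P.minLag ≤ P.maxLag :=
  P.le_maxLag P.minLag_mem.1 P.minLag_mem.2

variable {N₁ : ℕ}

theorem numUnknowns_eq (h : M ≤ N₁) :
    P.numUnknowns N₁ = P.maxLag - P.minLag + (N₁ + 1 - M) := by
  have h1 := P.maxLag_le
  have h2 := P.minLag_le_maxLag
  unfold numUnknowns lastIdx firstIdx
  omega

theorem numAux_eq (h : M ≤ N₁) : P.numAux N₁ = P.maxLag - P.minLag := by
  rw [numAux, P.numUnknowns_eq h]
  omega

theorem numUnknowns_eq_add (h : M ≤ N₁) :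
    P.numUnknowns N₁ = P.numAux N₁ + (N₁ + 1 - M) := by
  rw [P.numAux_eq h, P.numUnknowns_eq h]

theorem numUnknowns_pos (h : M ≤ N₁) : 0 < P.numUnknowns N₁ := by
  rw [P.numUnknowns_eq h]; omega

/-- In the rows of the scheme, the entry `(i, j)` belongs to the lag `minLag + i - j`; above the
diagonal this is below the smallest active lag. -/
theorem augMatrix_apply_eq_zero (h : M ≤ N₁) {i j : Fin (P.numUnknowns N₁)} (hij : i < j) :
    P.augMatrix N₁ i j = 0 := by
  have h0 := P.numAux_eq h
  have h1 := P.maxLag_le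
  have h2 := P.minLag_le_maxLag
  have hij' : (i : ℕ) < j := hij
  unfold augMatrix
  dsimp only
  split_ifs with h3 h4 h5
  · exact absurd h4 hij.ne
  · rfl
  · by_contra hne
    have := P.minLag_le h5.2 hne
    have h6 := h5.1
    unfold firstIdx at *
    omega
  · rfl

theorem augMatrix_apply_self (h : M ≤ N₁) (i : Fin (P.numUnknowns N₁)) :
    P.augMatrix N₁ i i = if (i : ℕ) < P.numAux N₁ then 1 else P.β P.minLag := by
  have h0 := P.numAux_eq h
  have h1 := P.maxLag_le
  have h2 := P.minLag_le_maxLag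
  unfold augMatrix firstIdx
  dsimp only
  by_cases h3 : (i : ℕ) < P.numAux N₁
  · simp [h3]
  · rw [if_neg h3, if_neg h3, if_pos ⟨by omega, by omega⟩]
    congr 1
    omega

theorem isUnit_det_augMatrix (h : M ≤ N₁) : IsUnit (P.augMatrix N₁).det := by
  rw [Matrix.det_of_isLowerTriangular _ fun i j hij => P.augMatrix_apply_eq_zero h hij,
    isUnit_iff_ne_zero, Finset.prod_ne_zero_iff]
  intro i _
  rw [P.augMatrix_apply_self h]
  split_ifs
  · exact one_ne_zero
  · exact P.minLag_mem.2

/-- The operator on Euclidean space given by `A_h`. -/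
noncomputable abbrev augOp (N₁ : ℕ) :
    EuclideanSpace ℝ (Fin (P.numUnknowns N₁)) →L[ℝ] EuclideanSpace ℝ (Fin (P.numUnknowns N₁)) :=
  Matrix.toEuclideanCLM (𝕜 := ℝ) (P.augMatrix N₁)

theorem augOp_apply (v : EuclideanSpace ℝ (Fin (P.numUnknowns N₁))) (i) :
    P.augOp N₁ v i = ∑ j, P.augMatrix N₁ i j * v j := rfl

/-- The last row is always an equation of the scheme, so its diagonal entry bounds the norm from
below, uniformly in `h`. -/
theorem abs_β_minLag_le_norm_augOp (h : M ≤ N₁) : |P.β P.minLag| ≤ ‖P.augOp N₁‖ := by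
  let i : Fin (P.numUnknowns N₁) :=
    ⟨P.numUnknowns N₁ - 1, by have := P.numUnknowns_pos h; omega⟩
  have hi : ¬ (i : ℕ) < P.numAux N₁ := by
    have := P.numUnknowns_eq_add h
    simp only [i]
    omega
  have h1 := (P.augOp N₁).le_opNorm (EuclideanSpace.single i 1)
  rw [PiLp.norm_single, norm_one, mul_one] at h1
  have h2 : P.augOp N₁ (EuclideanSpace.single i 1) i = P.β P.minLag := by
    rw [augOp_apply, Finset.sum_eq_single i]
    · simp [P.augMatrix_apply_self h, hi]
    · intro j _ hj
      simp [hj]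
    · simp
  rw [← h2, ← Real.norm_eq_abs]
  exact (PiLp.norm_apply_le _ i).trans h1

theorem norm_le_norm_inv_mul (h : M ≤ N₁) (v : EuclideanSpace ℝ (Fin (P.numUnknowns N₁))) :
    ‖v‖ ≤ ‖Matrix.toEuclideanCLM (𝕜 := ℝ) (P.augMatrix N₁)⁻¹‖ * ‖P.augOp N₁ v‖ := by
  have h1 : Matrix.toEuclideanCLM (𝕜 := ℝ) (P.augMatrix N₁)⁻¹ (P.augOp N₁ v) = v := by
    rw [augOp, ← mul_apply_eq_comp, ← map_mul,
      Matrix.nonsing_inv_mul _ (P.isUnit_det_augMatrix h), map_one,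
      one_apply_eq_self]
  conv_lhs => rw [← h1]
  exact ContinuousLinearMap.le_opNorm _ _

theorem norm_inv_pos (h : M ≤ N₁) :
    0 < ‖Matrix.toEuclideanCLM (𝕜 := ℝ) (P.augMatrix N₁)⁻¹‖ := by
  refine (norm_nonneg _).lt_of_ne fun h0 => ?_
  have h1 := P.norm_le_norm_inv_mul h (EuclideanSpace.single ⟨0, P.numUnknowns_pos h⟩ 1)
  rw [← h0, zero_mul, PiLp.norm_single, norm_one] at h1
  linarith

theorem cond_pos (h : M ≤ N₁) : 0 < P.cond N₁ :=
  mul_pos ((abs_pos.2 P.minLag_mem.2).trans_le (P.abs_β_minLag_le_norm_augOp h)) (P.norm_inv_pos h)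

variable {d p : ℕ} {μ : ℕ → ℝ} {x : ℝ → EuclideanSpace ℝ (Fin d)} {i : Fin d} {T : ℝ}

/-- The values of `u` at the states `x_r, …, x_q`. -/
noncomputable def values (x : ℝ → EuclideanSpace ℝ (Fin d)) (T : ℝ) (N₁ : ℕ)
    (u : EuclideanSpace ℝ (Fin d) → ℝ) : EuclideanSpace ℝ (Fin (P.numUnknowns N₁)) :=
  WithLp.toLp 2 fun j => u (x (gridPt T N₁ (P.firstIdx + j)))

/-- The right-hand side of the augmented system. -/
noncomputable def data (p : ℕ) (μ : ℕ → ℝ) (x : ℝ → EuclideanSpace ℝ (Fin d)) (i : Fin d)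
    (T : ℝ) (N₁ : ℕ) : EuclideanSpace ℝ (Fin (P.numUnknowns N₁)) :=
  WithLp.toLp 2 fun j => if (j : ℕ) < P.numAux N₁ then
      1 / (T / N₁) * ∑ m ∈ Finset.range (p + 1), μ m * x (gridPt T N₁ (P.firstIdx + j + m)) i
    else ∑ m ∈ Finset.range (M + 1),
      (T / N₁)⁻¹ * P.α m * x (gridPt T N₁ (M + (j - P.numAux N₁) - m)) i

theorem augOp_values_of_lt (u : EuclideanSpace ℝ (Fin d) → ℝ) {j : Fin (P.numUnknowns N₁)}
    (hj : (j : ℕ) < P.numAux N₁) :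
    P.augOp N₁ (P.values x T N₁ u) j = u (x (gridPt T N₁ (P.firstIdx + j))) := by
  rw [augOp_apply]
  simp [augMatrix, hj, values]

theorem augOp_values_of_le (h : M ≤ N₁) (u : EuclideanSpace ℝ (Fin d) → ℝ)
    {j : Fin (P.numUnknowns N₁)} (hj : P.numAux N₁ ≤ j) :
    P.augOp N₁ (P.values x T N₁ u) j = ∑ m ∈ Finset.range (M + 1),
      P.β m * u (x (gridPt T N₁ (M + (j - P.numAux N₁) - m))) := by
  set n := M + (j - P.numAux N₁) with hn
  have hτ := P.numUnknowns_eq_add h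
  have ha := P.numAux_eq h
  have h1 := P.maxLag_le
  have h2 := P.minLag_le_maxLag
  -- Each entry is spread over the lags so that the sums over columns and lags can be exchanged.
  have h3 : ∀ l : Fin (P.numUnknowns N₁), P.augMatrix N₁ j l * P.values x T N₁ u l
      = ∑ m ∈ Finset.range (M + 1), if n = m + (P.firstIdx + l) then
        P.β m * u (x (gridPt T N₁ (n - m))) else 0 := by
    intro l
    simp only [augMatrix, not_lt.2 hj, if_false, values, ← hn]
    split_ifs with h4
    · rw [Finset.sum_eq_single (n - (P.firstIdx + l))]
      · rw [if_pos (by omega), Nat.sub_sub_self h4.1]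
      · intro m _ hm
        rw [if_neg (by omega)]
      · intro hm
        exact absurd (Finset.mem_range.2 (by omega)) hm
    · rw [zero_mul, Finset.sum_eq_zero]
      intro m hm
      rw [Finset.mem_range] at hm
      rw [if_neg (by omega)]
  rw [augOp_apply, Finset.sum_congr rfl fun l _ => h3 l, Finset.sum_comm]
  refine Finset.sum_congr rfl fun m hm => ?_
  rw [Finset.mem_range] at hm
  by_cases hβ : P.β m = 0
  · simp [hβ]
  · have h5 := P.minLag_le (by omega) hβ
    have h6 := P.le_maxLag (by omega) hβ
    have hj' := j.2
    have hf : P.firstIdx = M - P.maxLag := rfl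
    -- An active lag lies between `minLag` and `maxLag`, so the index `n - m` is one of the
    -- unknowns.
    rw [Finset.sum_eq_single ⟨n - m - P.firstIdx, by omega⟩]
    · rw [if_pos]
      simp only
      omega
    · intro l _ hl
      rw [if_neg]
      intro h7
      exact hl (Fin.ext (by simp only; omega))
    · simp

theorem loss_eq (h : M ≤ N₁) (u : EuclideanSpace ℝ (Fin d) → ℝ) :
    P.loss p μ x i T N₁ u = 1 / (P.numUnknowns N₁ : ℝ) *
      ‖P.augOp N₁ (P.values x T N₁ u) - P.data p μ x i T N₁‖ ^ 2 := by
  rw [loss, EuclideanSpace.norm_sq_eq]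
  congr 1
  let F : ℕ → ℝ := fun j => if j < P.numAux N₁ then
      |u (x (gridPt T N₁ (P.firstIdx + j)))
          - 1 / (T / N₁) * ∑ m ∈ Finset.range (p + 1),
            μ m * x (gridPt T N₁ (P.firstIdx + j + m)) i| ^ 2
    else |(∑ m ∈ Finset.range (M + 1), P.β m * u (x (gridPt T N₁ (M + (j - P.numAux N₁) - m))))
          - ∑ m ∈ Finset.range (M + 1),
              (T / N₁)⁻¹ * P.α m * x (gridPt T N₁ (M + (j - P.numAux N₁) - m)) i| ^ 2
  have h1 : ∀ j : Fin (P.numUnknowns N₁),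
      ‖(P.augOp N₁ (P.values x T N₁ u) - P.data p μ x i T N₁) j‖ ^ 2 = F j := by
    intro j
    rw [PiLp.sub_apply, Real.norm_eq_abs]
    by_cases hj : (j : ℕ) < P.numAux N₁
    · rw [P.augOp_values_of_lt u hj]
      simp [F, data, hj]
    · rw [P.augOp_values_of_le h u (not_lt.1 hj)]
      simp [F, data, hj]
  rw [Finset.sum_congr rfl fun j _ => h1 j, ← Finset.sum_range, P.numUnknowns_eq_add h,
    Finset.sum_range_add, Finset.sum_Ico_eq_sum_range, add_tsub_cancel_left,
    ← Finset.Ico_succ_right_eq_Icc, Finset.sum_Ico_eq_sum_range]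
  congr 1
  · refine Finset.sum_congr rfl fun j hj => ?_
    simp [F, Finset.mem_range.1 hj]
  · refine Finset.sum_congr rfl fun j hj => ?_
    simp [F]

theorem seminorm_eq (g : EuclideanSpace ℝ (Fin d) → ℝ) :
    P.seminorm x T N₁ g = √(1 / (P.numUnknowns N₁ : ℝ)) * ‖P.values x T N₁ g‖ := by
  have hτ : P.lastIdx N₁ + 1 - P.firstIdx = P.numUnknowns N₁ := rfl
  rw [seminorm, Real.sqrt_mul (by positivity), EuclideanSpace.norm_eq,
    ← Finset.Ico_succ_right_eq_Icc, Finset.sum_Ico_eq_sum_range]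
  congr 2
  rw [Order.succ_eq_add_one, hτ, Finset.sum_range]
  rfl

theorem norm_le_sqrt_mul {n : ℕ} (v : EuclideanSpace ℝ (Fin n)) {e : ℝ} (he : 0 ≤ e)
    (h : ∀ j, |v j| ≤ e) : ‖v‖ ≤ √(n : ℝ) * e := by
  rw [EuclideanSpace.norm_eq]
  calc √(∑ j, ‖v j‖ ^ 2) ≤ √(∑ _j : Fin n, e ^ 2) :=
        Real.sqrt_le_sqrt (Finset.sum_le_sum fun j _ => pow_le_pow_left₀ (norm_nonneg _) (h j) 2)
    _ = √(n : ℝ) * e := by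
        rw [Finset.sum_const, Finset.card_univ, Fintype.card_fin, nsmul_eq_mul,
          Real.sqrt_mul (by positivity), Real.sqrt_sq he]

theorem values_sub (u v : EuclideanSpace ℝ (Fin d) → ℝ) :
    P.values x T N₁ (u - v) = P.values x T N₁ u - P.values x T N₁ v := rfl

/-- If `f` satisfies the augmented system up to `δ`, a minimizer of the loss is as good as any
competitor `w`, up to the condition number. -/
theorem seminorm_sub_le (h : M ≤ N₁) {f u w : EuclideanSpace ℝ (Fin d) → ℝ}
    (huw : P.loss p μ x i T N₁ u ≤ P.loss p μ x i T N₁ w) {δ e : ℝ} (hδ : 0 ≤ δ) (he : 0 ≤ e)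
    (hfδ : ∀ j, |(P.augOp N₁ (P.values x T N₁ f) - P.data p μ x i T N₁) j| ≤ δ)
    (hw : ∀ n ≤ N₁, |w (x (gridPt T N₁ n)) - f (x (gridPt T N₁ n))| ≤ e) :
    P.seminorm x T N₁ (u - f) ≤ P.cond N₁ * (e + 2 * δ / |P.β P.minLag|) := by
  set A := P.augOp N₁ with hA
  set b := P.data p μ x i T N₁ with hb
  set I := ‖Matrix.toEuclideanCLM (𝕜 := ℝ) (P.augMatrix N₁)⁻¹‖ with hI
  have hτ : 0 < (P.numUnknowns N₁ : ℝ) := by exact_mod_cast P.numUnknowns_pos h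
  set s := √(P.numUnknowns N₁ : ℝ) with hs
  have hs0 : 0 < s := Real.sqrt_pos.2 hτ
  have hres : ‖A (P.values x T N₁ u) - b‖ ≤ ‖A (P.values x T N₁ w) - b‖ := by
    rw [P.loss_eq h, P.loss_eq h] at huw
    exact (pow_le_pow_iff_left₀ (norm_nonneg _) (norm_nonneg _) two_ne_zero).1
      (le_of_mul_le_mul_left huw (by positivity))
  have hf := norm_le_sqrt_mul _ hδ hfδ
  have hwf : ‖P.values x T N₁ (w - f)‖ ≤ s * e := by
    refine norm_le_sqrt_mul _ he fun j => hw _ ?_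
    have hj := j.2
    have h1 := P.maxLag_le
    have h2 := P.minLag_le_maxLag
    have h3 := P.numUnknowns_eq h
    have hf : P.firstIdx = M - P.maxLag := rfl
    omega
  -- The residual of `f` enters twice, once in comparing `u` with `f` and once in comparing `w` with
  -- `f`; hence the factor `2`.
  have h1 : ‖A (P.values x T N₁ (u - f))‖ ≤ ‖A‖ * (s * e) + 2 * (s * δ) := by
    calc ‖A (P.values x T N₁ (u - f))‖
        = ‖(A (P.values x T N₁ u) - b) - (A (P.values x T N₁ f) - b)‖ := by
          rw [values_sub, map_sub]; congr 1; abel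
      _ ≤ ‖A (P.values x T N₁ w) - b‖ + s * δ := (norm_sub_le _ _).trans (add_le_add hres hf)
      _ = ‖A (P.values x T N₁ (w - f)) + (A (P.values x T N₁ f) - b)‖ + s * δ := by
          rw [values_sub, map_sub]; congr 2; abel
      _ ≤ (‖A‖ * (s * e) + s * δ) + s * δ := by
          gcongr
          refine (norm_add_le _ _).trans (add_le_add ?_ hf)
          exact (A.le_opNorm _).trans (mul_le_mul_of_nonneg_left hwf (norm_nonneg _))
      _ = _ := by ring
  have hβ : 0 < |P.β P.minLag| := abs_pos.2 P.minLag_mem.2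
  have hAβ : |P.β P.minLag| ≤ ‖A‖ := P.abs_β_minLag_le_norm_augOp h
  -- The consistency term lacks the factor `‖A‖` of the condition number; the lower bound on `‖A‖`
  -- supplies it.
  have h2 : 2 * δ ≤ ‖A‖ * (2 * δ / |P.β P.minLag|) := by
    rw [mul_div_assoc', le_div_iff₀ hβ, mul_comm]
    gcongr
  rw [P.seminorm_eq, Real.sqrt_div one_pos.le, Real.sqrt_one, ← hs, one_div,
    inv_mul_le_iff₀ hs0]
  calc ‖P.values x T N₁ (u - f)‖ ≤ I * ‖A (P.values x T N₁ (u - f))‖ :=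
        P.norm_le_norm_inv_mul h _
    _ ≤ I * (s * (‖A‖ * e + ‖A‖ * (2 * δ / |P.β P.minLag|))) := by
        gcongr
        refine h1.trans ?_
        nlinarith
    _ = s * (P.cond N₁ * (e + 2 * δ / |P.β P.minLag|)) := by
        rw [cond, ← hI]; ring

end LMM

/-! ### Consistency of the scheme and the error estimate. -/

theorem gridPt_mem {T : ℝ} (hT : 0 < T) {N₁ n : ℕ} (hN : 0 < N₁) (hn : n ≤ N₁) :
    gridPt T N₁ n ∈ Icc 0 T := by
  have hN' : (0 : ℝ) < N₁ := by exact_mod_cast hN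
  have hn' : (n : ℝ) ≤ N₁ := by exact_mod_cast hn
  unfold gridPt
  refine ⟨by positivity, ?_⟩
  calc (n : ℝ) * (T / N₁) ≤ N₁ * (T / N₁) := by gcongr
    _ = T := mul_div_cancel₀ _ hN'.ne'

theorem gridPt_add (T : ℝ) (N₁ n m : ℕ) :
    gridPt T N₁ (n + m) = gridPt T N₁ n + m * (T / N₁) := by
  simp only [gridPt, Nat.cast_add]; ring

namespace LMM

variable {M : ℕ} (P : LMM M) {d p : ℕ} {μ : ℕ → ℝ} {T : ℝ} {x : ℝ → EuclideanSpace ℝ (Fin d)}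
  {F : EuclideanSpace ℝ (Fin d) → EuclideanSpace ℝ (Fin d)} {i : Fin d}
  {f : EuclideanSpace ℝ (Fin d) → ℝ}

/-- The exact right-hand side satisfies the augmented system up to `O(h^p)`. -/
theorem exists_consistency_bound (hP : P.HasOrder p) (hμ : IsFiniteDifferenceOfOrder p μ)
    (hT : 0 < T) (hx : ContDiffOn ℝ ∞ x (Icc 0 T))
    (hode : ∀ t ∈ Icc 0 T, HasDerivWithinAt x (F (x t)) (Icc 0 T) t) (hf : ∀ y, f y = F y i) :
    ∃ C, 0 ≤ C ∧ ∀ N₁, P.Admissible p N₁ → ∀ j,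
      |(P.augOp N₁ (P.values x T N₁ f) - P.data p μ x i T N₁) j| ≤ C * (T / N₁) ^ p := by
  have hxi : ContDiffOn ℝ ∞ (fun t => x t i) (Icc 0 T) := contDiffOn_euclidean.1 hx i
  obtain ⟨C₁, hC₁⟩ := hμ (fun t => x t i) T hT hxi
  obtain ⟨C₂, hC₂⟩ := hP d F x T hT hx hode
  refine ⟨max (max C₁ C₂) 0, le_max_right _ _, fun N₁ hadm j => ?_⟩
  have hMN := hadm.1
  have hN : 0 < N₁ := P.steps_pos.trans hMN
  have hN' : (0 : ℝ) < N₁ := by exact_mod_cast hN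
  have hh : 0 < T / N₁ := by positivity
  have hle : ∀ C, C ≤ max C₁ C₂ → C * (T / N₁) ^ p ≤ max (max C₁ C₂) 0 * (T / N₁) ^ p :=
    fun C hC => mul_le_mul_of_nonneg_right (hC.trans (le_max_left _ _)) (by positivity)
  rw [PiLp.sub_apply]
  by_cases hj : (j : ℕ) < P.numAux N₁
  · have hidx := hadm.2 j hj
    have hmem := gridPt_mem hT hN (n := P.firstIdx + j) (by omega)
    have hmem' := gridPt_mem hT hN hidx
    rw [gridPt_add] at hmem'
    have h1 := hC₁ (T / N₁) (gridPt T N₁ (P.firstIdx + j)) hh hmem.1 hmem'.2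
    have hder : HasDerivWithinAt (fun t => x t i) (f (x (gridPt T N₁ (P.firstIdx + j))))
        (Icc 0 T) (gridPt T N₁ (P.firstIdx + j)) := by
      rw [hf]
      exact (EuclideanSpace.proj i : EuclideanSpace ℝ (Fin d) →L[ℝ] ℝ).hasFDerivAt.comp_hasDerivWithinAt
        _ (hode _ hmem)
    rw [hder.derivWithin (uniqueDiffOn_Icc hT _ hmem), abs_sub_comm] at h1
    rw [P.augOp_values_of_lt f hj]
    simp only [data, hj, if_true, gridPt_add T N₁ (P.firstIdx + j)]
    exact h1.trans (hle _ (le_max_left _ _))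
  · have hj2 := j.2
    have hτ := P.numUnknowns_eq_add hMN
    have h1 := hC₂ N₁ (M + (j - P.numAux N₁)) (by omega) (by omega)
    have h2 := (PiLp.norm_apply_le _ i).trans h1
    rw [P.augOp_values_of_le hMN f (not_lt.1 hj), abs_sub_comm]
    refine le_trans (le_of_eq ?_) (h2.trans (hle _ (le_max_right _ _)))
    rw [Real.norm_eq_abs]
    simp [data, hj, truncError, hf, Finset.mul_sum, mul_assoc]

theorem admissible_of_le {N₁ : ℕ} (h : 2 * M + p ≤ N₁) : P.Admissible p N₁ := by
  refine ⟨by omega, fun n hn => ?_⟩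
  rw [P.numAux_eq (by omega)] at hn
  have := P.maxLag_le
  have hf : P.firstIdx = M - P.maxLag := rfl
  omega

/-- The error of any global minimizer is bounded by the consistency error plus the error of best
approximation, up to the condition number. -/
theorem exists_error_bound (hP : P.HasOrder p) (hμ : IsFiniteDifferenceOfOrder p μ)
    (hT : 0 < T) (hx : ContDiffOn ℝ ∞ x (Icc 0 T))
    (hode : ∀ t ∈ Icc 0 T, HasDerivWithinAt x (F (x t)) (Icc 0 T) t) (hf : ∀ y, f y = F y i)
    {S : Set (EuclideanSpace ℝ (Fin d))} (hS : x '' Icc 0 T ⊆ S)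
    (hcont : UniformContinuousOn f S) {R : ℝ} (hSR : ∀ y ∈ S, ∀ l, |y l| ≤ R) :
    ∃ C, 0 < C ∧ ∀ N₁ k G N : ℕ, P.Admissible p N₁ → ∀ u,
      P.IsGlobalMinimizer p μ x i T R N₁ k G N u →
      P.seminorm x T N₁ (u - f) < C * P.cond N₁ * ((T / N₁) ^ p + bestError f S R k G N) := by
  obtain ⟨C₀, hC₀, hcons⟩ := P.exists_consistency_bound hP hμ hT hx hode hf
  obtain ⟨B, hB0, hB⟩ := exists_abs_le hSR hcont
  have hβ : 0 < |P.β P.minLag| := abs_pos.2 P.minLag_mem.2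
  set D := 2 * C₀ / |P.β P.minLag| with hD
  have hD0 : 0 ≤ D := by positivity
  -- The extra `1` makes the final inequality strict, since `η > 0`.
  refine ⟨D + 1, by positivity, fun N₁ k G N hadm u hu => ?_⟩
  have hN : 0 < N₁ := P.steps_pos.trans hadm.1
  have hN' : (0 : ℝ) < N₁ := by exact_mod_cast hN
  have hcond := P.cond_pos hadm.1
  set η := (T / N₁) ^ p with hη
  have hη0 : 0 < η := by positivity
  -- A best approximation need not exist, so the estimate is rearranged into a lower bound for every
  -- error level `e` attained by a network. The zero network shows that such levels exist.
  have key : P.seminorm x T N₁ (u - f) / P.cond N₁ - D * η ≤ bestError f S R k G N := by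
    refine le_csInf ⟨B, hB0, 0, zero_mem_kanClass d R k G N, fun y hy => by simpa using hB y hy⟩ ?_
    rintro e ⟨he, w, hw, hwe⟩
    have h := P.seminorm_sub_le hadm.1 (hu.2 hw) (by positivity) he (hcons N₁ hadm)
      fun n hn => hwe _ (hS ⟨_, gridPt_mem hT hN hn, rfl⟩)
    rw [sub_le_iff_le_add, div_le_iff₀ hcond, mul_comm]
    refine h.trans (le_of_eq ?_)
    rw [hD]; ring
  have hE : 0 ≤ bestError f S R k G N := bestError_nonneg
  rw [sub_le_iff_le_add, div_le_iff₀ hcond] at key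
  calc P.seminorm x T N₁ (u - f) ≤ (bestError f S R k G N + D * η) * P.cond N₁ := key
    _ < ((D + 1) * (η + bestError f S R k G N)) * P.cond N₁ := by
        gcongr
        nlinarith
    _ = (D + 1) * P.cond N₁ * (η + bestError f S R k G N) := by ring

end LMM

theorem exists_step_pow_lt (T : ℝ) {p : ℕ} (hp : 1 ≤ p) {ε : ℝ} (hε : 0 < ε) :
    ∃ K₀ : ℕ, ∀ N₁ : ℕ, K₀ ≤ N₁ → (T / N₁) ^ p < ε := by
  have h : Filter.Tendsto (fun n : ℕ => (T / n) ^ p) Filter.atTop (nhds 0) := by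
    simpa [Nat.one_le_iff_ne_zero.1 hp] using
      (tendsto_const_div_atTop_nhds_zero_nat T).pow p
  exact Filter.eventually_atTop.1 (h.eventually (gt_mem_nhds hε))

end KANLMM

/-! ### Assembly of the three claims. -/

open KANLMM
theorem mainTheorem6 {M d p : ℕ} (P : LMM M) (hp : 1 ≤ p) (hP : P.HasOrder p)
    (μ : ℕ → ℝ) (hμ : IsFiniteDifferenceOfOrder p μ)
    (T : ℝ) (hT : 0 < T)
    (x : ℝ → EuclideanSpace ℝ (Fin d)) (hx : ContDiffOn ℝ ∞ x (Icc 0 T))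
    (F : EuclideanSpace ℝ (Fin d) → EuclideanSpace ℝ (Fin d))
    (hode : ∀ t ∈ Icc 0 T, HasDerivWithinAt x (F (x t)) (Icc 0 T) t)
    (i : Fin d) (f : EuclideanSpace ℝ (Fin d) → ℝ) (hf : ∀ y, f y = F y i)
    (S : Set (EuclideanSpace ℝ (Fin d))) (hS : x '' Icc 0 T ⊆ S) (hconn : IsPreconnected S)
    (hcont : UniformContinuousOn f S)
    (R : ℝ) (hR : 0 < R) (hSR : ∀ y ∈ S, ∀ l, |y l| ≤ R) :
    (∀ k G N : ℕ, 1 ≤ k → 1 ≤ G → 1 ≤ N → bestError f S R k G N ≤ kanError f S R k G N) ∧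
    (∃ C : ℝ, 0 < C ∧
      ∀ N₁ k G N : ℕ, P.Admissible p N₁ → 1 ≤ k → 1 ≤ G → 1 ≤ N →
        ∀ fNN : EuclideanSpace ℝ (Fin d) → ℝ,
          P.IsGlobalMinimizer p μ x i T R N₁ k G N fNN →
          P.seminorm x T N₁ (fNN - f)
              < C * P.cond N₁ * ((T / N₁) ^ p + bestError f S R k G N) ∧
          P.seminorm x T N₁ (fNN - f)
              < C * P.cond N₁ * ((T / N₁) ^ p + kanError f S R k G N)) ∧
    ((∃ K : ℝ, ∀ N₁ : ℕ, M ≤ N₁ → P.cond N₁ ≤ K) →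
      ∀ ε > 0, ∃ K₀ : ℕ, ∀ k G N N₁ : ℕ, K₀ ≤ k → K₀ ≤ G → K₀ ≤ N → K₀ ≤ N₁ →
        ∀ fNN : EuclideanSpace ℝ (Fin d) → ℝ,
          P.IsGlobalMinimizer p μ x i T R N₁ k G N fNN →
          P.seminorm x T N₁ (fNN - f) < ε) := by
  have hne : S.Nonempty := ⟨x 0, hS ⟨0, ⟨le_rfl, hT.le⟩, rfl⟩⟩
  have h1 : ∀ k G N : ℕ, 1 ≤ k → 1 ≤ G → 1 ≤ N →
      bestError f S R k G N ≤ kanError f S R k G N := fun k G N hk hG hN =>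
    bestError_le_kanError hR hSR hne hconn hcont hk hG hN i.pos
  obtain ⟨C, hC, hbound⟩ := P.exists_error_bound hP hμ hT hx hode hf hS hcont hSR
  refine ⟨h1, ⟨C, hC, fun N₁ k G N hadm hk hG hN u hu => ?_⟩, ?_⟩
  · have h := hbound N₁ k G N hadm u hu
    have := P.cond_pos hadm.1
    refine ⟨h, h.trans_le ?_⟩
    gcongr
    exact h1 k G N hk hG hN
  · rintro ⟨K, hK⟩ ε hε
    have hK0 : 0 < K := (P.cond_pos le_rfl).trans_le (hK M le_rfl)
    obtain ⟨K₁, hK₁⟩ := exists_step_pow_lt T hp (ε := ε / (2 * (C * K))) (by positivity)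
    obtain ⟨K₂, hK₂⟩ := approximable_of_uniformContinuousOn hR hSR hcont
      (ε / (2 * (C * K))) (by positivity)
    -- The last summand makes the grid admissible; `K₁` and `K₂` control the step size and the best
    -- approximation error.
    refine ⟨K₁ + K₂ + (2 * M + p), fun k G N N₁ hk hG hN hN₁ u hu => ?_⟩
    have hadm : P.Admissible p N₁ := P.admissible_of_le (by omega)
    obtain ⟨w, hw, hwe⟩ := hK₂ k G N (by omega) (by omega) (by omega)
    have hE := bestError_le (by positivity) hw hwe
    have hE0 : 0 ≤ bestError f S R k G N := bestError_nonneg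
    have hη := hK₁ N₁ (by omega)
    calc P.seminorm x T N₁ (u - f)
        < C * P.cond N₁ * ((T / N₁) ^ p + bestError f S R k G N) := hbound N₁ k G N hadm u hu
      _ ≤ C * K * (ε / (2 * (C * K)) + ε / (2 * (C * K))) := by
          gcongr
          exact hK N₁ hadm.1
      _ = ε := by field_simp; norm_num
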